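/- Let $r \ge 0$ and let $\mathcal C$ be a polyhedral complex in $\mathbb R^r$, that is, a finite set of (convex) polyhedra in $\mathbb R^r$ (finite intersections of closed affine half-spaces; no rationality is assumed) which contains all faces of its members and in which the intersection of any two members is a face of both. Here a face of a polyhedron $\sigma$ is the empty set or the set of points of $\sigma$ at which some linear functional attains its maximum over $\sigma$; it is immaterial whether the empty face is listed in $\mathcal C$. Let $|\mathcal C| = \bigcup_{\sigma \in \mathcal C} \sigma$, and for $\sigma \in \mathcal C$ let $\mathbb L_\sigma \subseteq \mathbb R^r$ be the linear subspace parallel to the affine span of $\sigma$. For $V \subseteq \mathbb R^r$ open let $A^{p,q}(V) = A^p(V) \otimes_{\mathbb R} \Lambda^q (\mathbb R^r)^*$, where $A^p(V)$ is the space of smooth real differential $p$-forms on $V$, and let $d' = D \otimes \mathrm{id} : A^{p,q}(V) \to A^{p+1,q}(V)$, where $D$ is the exterior derivative. The space $A^{p,q}(|\mathcal C|)$ of superforms of bidegree $(p,q)$ on $|\mathcal C|$ consists of the forms $\alpha \in A^{p,q}(V)$ on open sets $V \supseteq |\mathcal C|$ of $\mathbb R^r$, where $\alpha \in A^{p,q}(V)$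 and $\beta \in A^{p,q}(W)$ are identified if for all $\sigma \in \mathcal C$, all $x \in \sigma$ and all $v_1,\dots,v_p,w_1,\dots,w_q \in \mathbb L_\sigma$ $$\langle \alpha(x); v_1,\dots,v_p,w_1,\dots,w_q\rangle = \langle \beta(x); v_1,\dots,v_p,w_1,\dots,w_q\rangle .$$ The operator $d'$ induces a differential $d' : A^{p,q}(|\mathcal C|) \to A^{p+1,q}(|\mathcal C|)$; let $$H^{p,q}_{d'}(|\mathcal C|) = \frac{\ker\bigl(d' : A^{p,q}(|\mathcal C|) \to A^{p+1,q}(|\mathcal C|)\bigr)}{\operatorname{im}\bigl(d' : A^{p-1,q}(|\mathcal C|) \to A^{p,q}(|\mathcal C|)\bigr)},$$ where $A^{-1,q}(|\mathcal C|) = 0$. Theorem. For all $p, q \in \mathbb N_0$, the real vector space $H^{p,q}_{d'}(|\mathcal C|)$ is finite dimensional. -/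

import Mathlib

open scoped ContDiff Topology

noncomputable section

section Superforms

variable {E : Type*} [NormedAddCommGroup E] [NormedSpace ℝ E]

/-- A (convex) polyhedron: the intersection of finitely many closed affine half-spaces. -/
def IsPolyhedron (σ : Set E) : Prop :=
  ∃ (m : ℕ) (u : Fin m → E →L[ℝ] ℝ) (c : Fin m → ℝ), σ = {x | ∀ i, u i x ≤ c i}

variable (E) in
/-- A polyhedral complex: a finite set of polyhedra which contains the faces of its members and in
which any two members meet in a face of both.

The faces of a polyhedron are its exposed subsets: `IsExposed ℝ σ τ` says that `τ` is empty or the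
set of points of `σ` at which some linear functional (possibly `0`, which gives `σ` itself)
attains its maximum over `σ`. The empty set is thus a face of every polyhedron; it may, but need
not, be listed as a member of the complex. -/
structure PolyhedralComplex where
  /-- The polyhedra of the complex. -/
  polyhedra : Set (Set E)
  finite_polyhedra : polyhedra.Finite
  isPolyhedron : ∀ σ ∈ polyhedra, IsPolyhedron σ
  face_mem : ∀ σ ∈ polyhedra, ∀ τ : Set E, IsExposed ℝ σ τ → τ.Nonempty → τ ∈ polyhedra
  inter_face : ∀ σ ∈ polyhedra, ∀ τ ∈ polyhedra,
    IsExposed ℝ σ (σ ∩ τ) ∧ IsExposed ℝ τ (σ ∩ τ)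

variable (E) in
/-- The space `Λ^q E*` of alternating `q`-linear forms on `E`, with its usual norm. -/
def ConstForm (q : ℕ) : Type _ := E [⋀^Fin q]→L[ℝ] ℝ

namespace ConstForm

instance (q : ℕ) : NormedAddCommGroup (ConstForm E q) :=
  inferInstanceAs (NormedAddCommGroup (E [⋀^Fin q]→L[ℝ] ℝ))

instance (q : ℕ) : NormedSpace ℝ (ConstForm E q) :=
  inferInstanceAs (NormedSpace ℝ (E [⋀^Fin q]→L[ℝ] ℝ))

instance (q : ℕ) : FunLike (ConstForm E q) (Fin q → E) ℝ :=
  inferInstanceAs (FunLike (E [⋀^Fin q]→L[ℝ] ℝ) (Fin q → E) ℝ)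

/-- Evaluation of alternating `q`-forms at `q` vectors, as a continuous linear map. -/
def evalCLM {q : ℕ} (w : Fin q → E) : ConstForm E q →L[ℝ] ℝ :=
  ContinuousAlternatingMap.apply ℝ E ℝ w

@[simp] theorem evalCLM_apply {q : ℕ} (w : Fin q → E) (β : ConstForm E q) :
    evalCLM w β = β w := rfl

@[simp] theorem zero_apply {q : ℕ} (w : Fin q → E) : (0 : ConstForm E q) w = 0 := rfl

@[simp] theorem add_apply {q : ℕ} (β γ : ConstForm E q) (w : Fin q → E) :
    (β + γ) w = β w + γ w := rfl

@[simp] theorem smul_apply {q : ℕ} (c : ℝ) (β : ConstForm E q) (w : Fin q → E) :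
    (c • β) w = c * β w := rfl

end ConstForm

variable (E) in
/-- The space `Λ^p E* ⊗ Λ^q E*` in which superforms of bidegree `(p, q)` take their values, as the
space of alternating `p`-linear maps with values in `Λ^q E*`. The pairing
`⟨a; v₁, …, v_p, w₁, …, w_q⟩` is `a v w`. A superform of bidegree `(p, q)` on an open set `V` is a
map to this space which is smooth on `V`, that is, a smooth differential `p`-form on `V` with
coefficients in the constant vector space `Λ^q E*`. -/
abbrev SuperformValue (p q : ℕ) : Type _ := E [⋀^Fin p]→L[ℝ] ConstForm E q

namespace PolyhedralComplex

/-- The support `|C|`: the union of the polyhedra of `C`. -/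
def support (C : PolyhedralComplex E) : Set E := ⋃₀ C.polyhedra

variable (C : PolyhedralComplex E) (p q : ℕ) (Ω : TopologicalSpace.Opens C.support)

/-- The maps that are smooth superforms of bidegree `(p, q)` on some open `V ⊆ E` with
`V ∩ |C| = Ω`; values outside of such a `V` are arbitrary (and irrelevant once the map is
restricted to `Ω`). -/
def representatives : Submodule ℝ (E → SuperformValue E p q) where
  carrier := {α | ∃ V : Set E, IsOpen V ∧ ((↑) : C.support → E) ⁻¹' V = (Ω : Set C.support) ∧
    ContDiffOn ℝ ∞ α V}
  add_mem' := by
    rintro α η ⟨V, hV, hVΩ, hα⟩ ⟨W, hW, hWΩ, hη⟩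
    refine ⟨V ∩ W, hV.inter hW, ?_,
      (hα.mono Set.inter_subset_left).add (hη.mono Set.inter_subset_right)⟩
    rw [Set.preimage_inter, hVΩ, hWΩ, Set.inter_self]
  zero_mem' := by
    obtain ⟨V, hV, hVΩ⟩ := isOpen_induced_iff.1 Ω.isOpen
    exact ⟨V, hV, hVΩ, contDiffOn_const⟩
  smul_mem' := by
    rintro c α ⟨V, hV, hVΩ, hα⟩
    exact ⟨V, hV, hVΩ, hα.const_smul c⟩

/-- The maps whose restriction to `σ ∩ Ω` is zero for all `σ ∈ C`: they vanish at each point of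
`σ ∩ Ω` on all vectors that are tangent to `σ`, i.e. lie in the linear subspace parallel to the
affine span of `σ`. -/
def vanishing : Submodule ℝ (E → SuperformValue E p q) where
  carrier := {α | ∀ x ∈ Ω, ∀ σ ∈ C.polyhedra, (x : E) ∈ σ →
    ∀ v : Fin p → E, (∀ i, v i ∈ (affineSpan ℝ σ).direction) →
    ∀ w : Fin q → E, (∀ j, w j ∈ (affineSpan ℝ σ).direction) → α x v w = 0}
  add_mem' := by
    intro α η hα hη x hx σ hσ hxσ v hv w hw
    simp [hα x hx σ hσ hxσ v hv w hw, hη x hx σ hσ hxσ v hv w hw]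
  zero_mem' := by
    intro x hx σ hσ hxσ v hv w hw
    simp
  smul_mem' := by
    intro c α hα x hx σ hσ hxσ v hv w hw
    simp [hα x hx σ hσ hxσ v hv w hw]

/-- The space `A^{p,q}(Ω)` of superforms of bidegree `(p, q)` on an open subset `Ω` of `|C|`:
superforms on open `V ⊆ E` with `V ∩ |C| = Ω`, two of them being identified if their restrictions
to `σ ∩ Ω` agree for every `σ ∈ C`. -/
abbrev Superform : Type _ :=
  C.representatives p q Ω ⧸ (C.vanishing p q Ω).submoduleOf (C.representatives p q Ω)

variable {C p q Ω}

theorem differentiableAt_of_contDiffOn {F : Type*} [NormedAddCommGroup F] [NormedSpace ℝ F]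
    {α : E → F} {V : Set E} (hV : IsOpen V) (hα : ContDiffOn ℝ ∞ α V) {x : E} (hx : x ∈ V) :
    DifferentiableAt ℝ α x :=
  (hα.contDiffAt (hV.mem_nhds hx)).differentiableAt (by simp)

theorem contDiffOn_extDeriv {α : E → SuperformValue E p q} {V : Set E} (hV : IsOpen V)
    (hα : ContDiffOn ℝ ∞ α V) : ContDiffOn ℝ ∞ (extDeriv α) V :=
  (ContinuousAlternatingMap.alternatizeUncurryFinCLM ℝ E (ConstForm E q)).contDiff.comp_contDiffOn
    (hα.fderiv_of_isOpen hV (by simp))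

theorem extDeriv_mem_representatives {α : E → SuperformValue E p q}
    (hα : α ∈ C.representatives p q Ω) : extDeriv α ∈ C.representatives (p + 1) q Ω := by
  obtain ⟨V, hV, hVΩ, h⟩ := hα
  exact ⟨V, hV, hVΩ, contDiffOn_extDeriv hV h⟩

theorem mem_open_of_mem {V : Set E} (hVΩ : ((↑) : C.support → E) ⁻¹' V = (Ω : Set C.support))
    {x : C.support} (hx : x ∈ Ω) : (x : E) ∈ V := by
  have : x ∈ ((↑) : C.support → E) ⁻¹' V := by rw [hVΩ]; exact hx
  exact this

theorem _root_.IsPolyhedron.convex {σ : Set E} (hσ : IsPolyhedron σ) : Convex ℝ σ := by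
  obtain ⟨m, u, c, rfl⟩ := hσ
  rw [Set.ofPred_forall]
  exact convex_iInter fun i => convex_halfSpace_le (u i).toLinearMap.isLinear (c i)

/-- A function that vanishes on a convex set near one of its points has zero derivative there in
the directions tangent to the set. -/
theorem fderiv_eq_zero_of_tangent {F : Type*} [NormedAddCommGroup F] [NormedSpace ℝ F]
    {σ : Set E} (hσ : Convex ℝ σ) {f : E → F} {x : E} (hx : x ∈ σ) (hf : DifferentiableAt ℝ f x)
    (h0 : ∀ᶠ y in 𝓝[σ] x, f y = 0) {v : E} (hv : v ∈ (affineSpan ℝ σ).direction) :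
    fderiv ℝ f x v = 0 := by
  rw [direction_affineSpan, vectorSpan_eq_span_vsub_set_right ℝ hx] at hv
  refine Submodule.span_induction ?_ (by simp) (fun a b _ _ ha hb => by simp [ha, hb])
    (fun c a _ ha => by simp [ha]) hv
  rintro _ ⟨y, hy, rfl⟩
  have h1 : HasFDerivWithinAt f (fderiv ℝ f x) σ x := hf.hasFDerivAt.hasFDerivWithinAt
  have h2 : HasFDerivWithinAt f (0 : E →L[ℝ] F) σ x :=
    (hasFDerivWithinAt_const (0 : F) x σ).congr_of_eventuallyEq h0 (h0.self_of_nhdsWithin hx)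
  have := h1.unique_on h2 (mem_tangentConeAt_of_segment_subset (hσ.segment_subset hx hy))
  simpa using this

/-- Taking `d'` is compatible with restriction to polyhedra. -/
theorem extDeriv_mem_vanishing {α : E → SuperformValue E p q}
    (hα : α ∈ C.representatives p q Ω) (h0 : α ∈ C.vanishing p q Ω) :
    extDeriv α ∈ C.vanishing (p + 1) q Ω := by
  obtain ⟨V, hV, hVΩ, h⟩ := hα
  intro x hx σ hσ hxσ v hv w hw
  have hd : DifferentiableAt ℝ α x := differentiableAt_of_contDiffOn hV h (mem_open_of_mem hVΩ hx)
  rw [extDeriv, ContinuousAlternatingMap.alternatizeUncurryFin_apply]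
  have key : ∀ i, (fderiv ℝ α x (v i)) (i.removeNth v) w = 0 := by
    intro i
    let L : SuperformValue E p q →L[ℝ] ℝ :=
      (ConstForm.evalCLM w).comp
        (ContinuousAlternatingMap.apply ℝ E (ConstForm E q) (i.removeNth v))
    have hL : HasFDerivAt (fun y => L (α y)) (L.comp (fderiv ℝ α x)) x :=
      L.hasFDerivAt.comp (x : E) hd.hasFDerivAt
    have := fderiv_eq_zero_of_tangent (C.isPolyhedron σ hσ).convex hxσ hL.differentiableAt ?_ (hv i)
    · rw [hL.fderiv] at this
      exact this
    · filter_upwards [self_mem_nhdsWithin,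
        mem_nhdsWithin_of_mem_nhds (hV.mem_nhds (mem_open_of_mem hVΩ hx))] with y hy hyV
      have hyC : y ∈ C.support := ⟨σ, hσ, hy⟩
      have hyΩ : (⟨y, hyC⟩ : C.support) ∈ Ω := by
        change _ ∈ (Ω : Set C.support)
        rw [← hVΩ]; exact hyV
      exact h0 ⟨y, hyC⟩ hyΩ σ hσ hy _ (fun j => hv _) w hw
  rw [← ConstForm.evalCLM_apply, map_sum]
  refine Finset.sum_eq_zero fun i _ => ?_
  rw [map_zsmul, ConstForm.evalCLM_apply, key i, smul_zero]

variable (C p q Ω)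

/-- `d'` on representatives: a superform on an open subset of `E`, that is, a `p`-form with
coefficients in `Λ^q E*`, is sent to the class of its exterior derivative. -/
def dPrimeAux : C.representatives p q Ω →ₗ[ℝ] C.Superform (p + 1) q Ω where
  toFun α := Submodule.Quotient.mk ⟨extDeriv α.1, extDeriv_mem_representatives α.2⟩
  map_add' := by
    rintro ⟨α, V, hV, hVΩ, hα⟩ ⟨η, W, hW, hWΩ, hη⟩
    rw [← Submodule.Quotient.mk_add, Submodule.Quotient.eq]
    intro x hx σ hσ hxσ v hv w hw
    have := extDeriv_add (differentiableAt_of_contDiffOn hV hα (mem_open_of_mem hVΩ hx))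
      (differentiableAt_of_contDiffOn hW hη (mem_open_of_mem hWΩ hx))
    simp [this]
  map_smul' := by
    rintro c ⟨α, hα⟩
    rw [RingHom.id_apply, ← Submodule.Quotient.mk_smul]
    congr 1
    ext1
    exact funext fun x => extDeriv_smul c α

/-- The differential `d' : A^{p,q}(Ω) → A^{p+1,q}(Ω)`. -/
def dPrime : C.Superform p q Ω →ₗ[ℝ] C.Superform (p + 1) q Ω :=
  Submodule.liftQ _ (C.dPrimeAux p q Ω) (by
    intro α hα
    rw [LinearMap.mem_ker]
    exact (Submodule.Quotient.mk_eq_zero _).2 (extDeriv_mem_vanishing α.2 hα))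

/-- `d'` is a differential. -/
theorem dPrime_dPrime (a : C.Superform p q Ω) :
    C.dPrime (p + 1) q Ω (C.dPrime p q Ω a) = 0 := by
  obtain ⟨⟨α, V, hV, hVΩ, hα⟩, rfl⟩ := Submodule.Quotient.mk_surjective _ a
  refine (Submodule.Quotient.mk_eq_zero _).2 ?_
  intro x hx σ hσ hxσ v hv w hw
  have := extDeriv_extDeriv_apply (hα.contDiffAt (hV.mem_nhds (mem_open_of_mem hVΩ hx)))
    (by simp only [minSmoothness_of_isRCLikeNormedField]; exact WithTop.coe_le_coe.2 le_top)
  change extDeriv (extDeriv α) x v w = 0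
  simp [this]

/-- The `d'`-closed superforms of bidegree `(p, q)` on `Ω`. -/
def closedForms : Submodule ℝ (C.Superform p q Ω) := LinearMap.ker (C.dPrime p q Ω)

/-- The `d'`-exact superforms of bidegree `(p, q)` on `Ω`; only zero is exact if `p = 0`. -/
def exactForms : (p : ℕ) → Submodule ℝ (C.Superform p q Ω)
  | 0 => ⊥
  | p + 1 => LinearMap.range (C.dPrime p q Ω)

theorem exactForms_le_closedForms : C.exactForms q Ω p ≤ C.closedForms p q Ω := by
  cases p with
  | zero => exact bot_le
  | succ p =>
    rintro _ ⟨a, rfl⟩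
    exact C.dPrime_dPrime p q Ω a

/-- The cohomology `H^{p,q}_{d'}(Ω)`: closed superforms modulo exact ones. -/
abbrev Cohomology : Type _ :=
  C.closedForms p q Ω ⧸ (C.exactForms q Ω p).submoduleOf (C.closedForms p q Ω)

end PolyhedralComplex

end Superforms

end

/-!
The support is a finite union of open stars `C.openStar T`, where the open star of a nonempty set `T`
consists of the points all of whose polyhedra contain `T`. The intersection of the open stars of `T`
and `T'` is the open star of `T ∪ T'`. Hence, by induction on the number of open stars in a union, it
suffices to know that the cohomology of one open star is finite-dimensional, and that this
finiteness passes from `U`, `W` and (one degree lower) `U ⊓ W` to `U ⊔ W`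
(`PolyhedralComplex.finiteModExact_sup_openStar`).

The second fact is the Mayer–Vietoris sequence (`PolyhedralComplex.FiniteModExact.sup`): superforms
form a sheaf on the support, and smooth cutoff functions on the ambient space glue superforms and
decompose those on `U ⊓ W`.

The first is a Poincaré lemma. A nonempty open star is star-shaped about a point `x₀` in the relative
interior of the smallest polyhedron containing `T`
(`PolyhedralComplex.exists_isStarShaped_openStar`), and `x₀` lies in every polyhedron that meets the
star. So the classical homotopy operator for the contraction to `x₀` (`radialHomotopy`, with
`extDeriv_radialHomotopy`) respects the identification of forms with equal restrictions to the
polyhedra. Closed forms of positive degree are therefore exact on an open star, and closed forms of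
degree `0` come from the finite-dimensional space of constant forms
(`PolyhedralComplex.IsStarShaped.finiteModExact`).
-/

noncomputable section

/-! ### Smooth dependence of integrals on parameters -/

section ParametricIntegral

universe u

variable {H : Type u} [NormedAddCommGroup H] [NormedSpace ℝ H] [FiniteDimensional ℝ H]

/-- Differentiation under the integral sign over `[0, 1]`, for an integrand that is smooth on an
open set containing `{x} × [0, 1]`. -/
theorem hasFDerivAt_intervalIntegral_of_contDiffOn {F : Type u} [NormedAddCommGroup F]
    [NormedSpace ℝ F] {f : H × ℝ → F} {W : Set (H × ℝ)} (hW : IsOpen W)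
    (hf : ContDiffOn ℝ ∞ f W) {x : H} (hx : ∀ t ∈ Set.Icc (0 : ℝ) 1, (x, t) ∈ W) :
    HasFDerivAt (fun y => ∫ t in (0 : ℝ)..1, f (y, t))
      (∫ t in (0 : ℝ)..1, (fderiv ℝ f (x, t)).comp (ContinuousLinearMap.inl ℝ H ℝ)) x := by
  have := FiniteDimensional.proper_real H
  have hf' : ContinuousOn (fun z => (fderiv ℝ f z).comp (ContinuousLinearMap.inl ℝ H ℝ)) W :=
    (hf.continuousOn_fderiv_of_isOpen hW (by simp)).clm_comp continuousOn_const
  -- By the tube lemma, a compact neighbourhood of `{x} × [0, 1]` lies in `W`; the derivative of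
  -- the integrand is bounded on it, which gives the dominating function.
  obtain ⟨u, v, hu, -, hxu, hv, huv⟩ := generalized_tube_lemma (isCompact_singleton (x := x))
    (isCompact_Icc (a := (0 : ℝ)) (b := 1)) hW (by rintro ⟨y, t⟩ ⟨rfl, ht⟩; exact hx t ht)
  obtain ⟨ε, hε, hεu⟩ := Metric.nhds_basis_closedBall.mem_iff.1 (hu.mem_nhds (hxu rfl))
  have hsub : Metric.closedBall x ε ×ˢ Set.Icc (0 : ℝ) 1 ⊆ W :=
    (Set.prod_mono hεu hv).trans huv
  obtain ⟨M, hM⟩ := ((isCompact_closedBall x ε).prod isCompact_Icc).exists_bound_of_continuousOn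
    (hf'.mono hsub)
  have hI : Set.uIoc (0 : ℝ) 1 ⊆ Set.Icc 0 1 := by
    rw [Set.uIoc_of_le zero_le_one]; exact Set.Ioc_subset_Icc_self
  have hslice : ∀ {G : Type u} [NormedAddCommGroup G] {g : H × ℝ → G}, ContinuousOn g W →
      ∀ y ∈ Metric.closedBall x ε, ContinuousOn (fun t => g (y, t)) (Set.Icc 0 1) :=
    fun hg y hy => hg.comp (by fun_prop) fun t ht => hsub ⟨hy, ht⟩
  refine intervalIntegral.hasFDerivAt_integral_of_dominated_of_fderiv_le
    (F := fun y t => f (y, t))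
    (F' := fun y t => (fderiv ℝ f (y, t)).comp (ContinuousLinearMap.inl ℝ H ℝ))
    (bound := fun _ => M)
    (Metric.closedBall_mem_nhds x hε) ?_ ?_ ?_ ?_ ?_ ?_
  · filter_upwards [Metric.closedBall_mem_nhds x hε] with y hy
    exact ((hslice hf.continuousOn y hy).mono hI).aestronglyMeasurable measurableSet_uIoc
  · apply ContinuousOn.intervalIntegrable
    rw [Set.uIcc_of_le zero_le_one]
    exact hslice hf.continuousOn x (Metric.mem_closedBall_self hε.le)
  · exact ((hslice hf' x (Metric.mem_closedBall_self hε.le)).mono hI).aestronglyMeasurable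
      measurableSet_uIoc
  · exact Filter.Eventually.of_forall fun t ht y hy => hM (y, t) ⟨hy, hI ht⟩
  · exact intervalIntegrable_const
  · refine Filter.Eventually.of_forall fun t ht y hy => ?_
    have hd : HasFDerivAt f (fderiv ℝ f (y, t)) (y, t) :=
      ((hf.contDiffAt (hW.mem_nhds (hsub ⟨hy, hI ht⟩))).differentiableAt (by simp)).hasFDerivAt
    exact hd.comp y (hasFDerivAt_prodMk_left y t)

/-- Integrals over `[0, 1]` of smooth functions depend smoothly on parameters. The derivative is an
integral of the same kind, with values in another space, so the induction on the order of
differentiability generalizes over the codomain. -/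
theorem contDiffOn_intervalIntegral {F : Type u} [NormedAddCommGroup F]
    [NormedSpace ℝ F] {f : H × ℝ → F} {W : Set (H × ℝ)} (hW : IsOpen W)
    (hf : ContDiffOn ℝ ∞ f W) {V : Set H} (hV : IsOpen V)
    (hVW : ∀ x ∈ V, ∀ t ∈ Set.Icc (0 : ℝ) 1, (x, t) ∈ W) :
    ContDiffOn ℝ ∞ (fun y => ∫ t in (0 : ℝ)..1, f (y, t)) V := by
  rw [contDiffOn_infty]
  intro n
  induction n generalizing F with
  | zero =>
    exact contDiffOn_zero.2 fun x hx =>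
      (hasFDerivAt_intervalIntegral_of_contDiffOn hW hf (hVW x hx)).continuousAt.continuousWithinAt
  | succ n ih =>
    push_cast
    rw [contDiffOn_succ_iff_fderiv_of_isOpen hV]
    refine ⟨fun x hx => (hasFDerivAt_intervalIntegral_of_contDiffOn hW hf
      (hVW x hx)).differentiableAt.differentiableWithinAt, by simp, ?_⟩
    refine (ih (f := fun z => (fderiv ℝ f z).comp (ContinuousLinearMap.inl ℝ H ℝ))
      ((hf.fderiv_of_isOpen hW (by simp)).clm_comp contDiffOn_const)).congr fun x hx => ?_
    exact (hasFDerivAt_intervalIntegral_of_contDiffOn hW hf (hVW x hx)).fderiv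

end ParametricIntegral

/-! ### Integrals along segments from a centre -/

section Segment

universe u

variable {E X Y : Type u} [NormedAddCommGroup E] [NormedSpace ℝ E] [NormedAddCommGroup X]
  [NormedSpace ℝ X] [NormedAddCommGroup Y] [NormedSpace ℝ Y] {V : Set E} {x₀ x : E}

theorem StarConvex.segment_mem (hV : StarConvex ℝ x₀ V) (hx : x ∈ V) {t : ℝ}
    (ht : t ∈ Set.Icc (0 : ℝ) 1) : x₀ + t • (x - x₀) ∈ V :=
  hV.add_smul_sub_mem hx ht.1 ht.2

theorem hasDerivAt_comp_segment {f : E → X}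
    (t : ℝ) (hf : DifferentiableAt ℝ f (x₀ + t • (x - x₀))) :
    HasDerivAt (fun s : ℝ => f (x₀ + s • (x - x₀)))
      (fderiv ℝ f (x₀ + t • (x - x₀)) (x - x₀)) t := by
  have h1 : HasDerivAt (fun s : ℝ => x₀ + s • (x - x₀)) (x - x₀) t := by
    simpa using ((hasDerivAt_id t).smul_const (x - x₀)).const_add x₀
  exact hf.hasFDerivAt.comp_hasDerivAt t h1

theorem ContinuousOn.comp_segment {G : Type*} [TopologicalSpace G] {f : E → G}
    (hf : ContinuousOn f V) (hV : StarConvex ℝ x₀ V) (hx : x ∈ V) :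
    ContinuousOn (fun t : ℝ => f (x₀ + t • (x - x₀))) (Set.Icc 0 1) :=
  hf.comp (by fun_prop) fun _ ht => hV.segment_mem hx ht

theorem ContinuousOn.intervalIntegrable_zero_one {G : Type*} [NormedAddCommGroup G] {g : ℝ → G}
    (hg : ContinuousOn g (Set.Icc 0 1)) :
    IntervalIntegrable g MeasureTheory.volume 0 1 := by
  apply ContinuousOn.intervalIntegrable
  rwa [Set.uIcc_of_le zero_le_one]

theorem ContDiffOn.differentiableAt_segment {α : E → X} (hV : IsOpen V) (hVx : StarConvex ℝ x₀ V)
    (hα : ContDiffOn ℝ ∞ α V) (hx : x ∈ V) {t : ℝ} (ht : t ∈ Set.Icc (0 : ℝ) 1) :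
    DifferentiableAt ℝ α (x₀ + t • (x - x₀)) :=
  (hα.contDiffAt (hV.mem_nhds (hVx.segment_mem hx ht))).differentiableAt (by simp)

theorem ContDiffOn.continuousOn_fderiv_segment {α : E → X} (hV : IsOpen V)
    (hVx : StarConvex ℝ x₀ V) (hα : ContDiffOn ℝ ∞ α V) (hx : x ∈ V) :
    ContinuousOn (fun t : ℝ => fderiv ℝ α (x₀ + t • (x - x₀))) (Set.Icc 0 1) :=
  (hα.continuousOn_fderiv_of_isOpen hV (by simp)).comp_segment hVx hx

theorem integral_fderiv_segment [CompleteSpace X] {α : E → X} (hV : IsOpen V)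
    (hVx : StarConvex ℝ x₀ V) (hα : ContDiffOn ℝ ∞ α V) (hx : x ∈ V) :
    ∫ t in (0 : ℝ)..1, fderiv ℝ α (x₀ + t • (x - x₀)) (x - x₀) = α x - α x₀ := by
  have := intervalIntegral.integral_eq_sub_of_hasDerivAt (a := 0) (b := 1)
    (f := fun t : ℝ => α (x₀ + t • (x - x₀))) (fun t ht => hasDerivAt_comp_segment t ?_) ?_
  · simpa using this
  · rw [Set.uIcc_of_le zero_le_one] at ht
    exact hα.differentiableAt_segment hV hVx hx ht
  · exact ((hα.continuousOn_fderiv_segment hV hVx hx).clm_apply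
      continuousOn_const).intervalIntegrable_zero_one

/-- The integrand is the derivative of `t ^ (p + 1) • α (x₀ + t • (x - x₀))`, which vanishes at
`t = 0`. -/
theorem integral_deriv_pow_smul_segment [CompleteSpace X] {α : E → X} (hV : IsOpen V)
    (hVx : StarConvex ℝ x₀ V) (hα : ContDiffOn ℝ ∞ α V) (hx : x ∈ V) (p : ℕ) :
    ∫ t in (0 : ℝ)..1, (t ^ (p + 1) • fderiv ℝ α (x₀ + t • (x - x₀)) (x - x₀)
      + ((p + 1 : ℕ) * t ^ p) • α (x₀ + t • (x - x₀))) = α x := by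
  have := intervalIntegral.integral_eq_sub_of_hasDerivAt (a := 0) (b := 1)
    (f := fun t : ℝ => t ^ (p + 1) • α (x₀ + t • (x - x₀)))
    (f' := fun t => t ^ (p + 1) • fderiv ℝ α (x₀ + t • (x - x₀)) (x - x₀)
      + ((p + 1 : ℕ) * t ^ p) • α (x₀ + t • (x - x₀)))
    (fun t ht => ?_) ?_
  · rw [this]
    simp
  · rw [Set.uIcc_of_le zero_le_one] at ht
    exact (hasDerivAt_pow (p + 1) t).smul
      (hasDerivAt_comp_segment t (hα.differentiableAt_segment hV hVx hx ht))
  · exact (((continuousOn_pow _).smul ((hα.continuousOn_fderiv_segment hV hVx hx).clm_apply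
      continuousOn_const)).add ((continuousOn_const.mul (continuousOn_pow p)).smul
        (hα.continuousOn.comp_segment hVx hx))).intervalIntegrable_zero_one

theorem contDiffOn_radial_integrand (Λ : X →L[ℝ] E →L[ℝ] Y) (p : ℕ) {α : E → X}
    (hα : ContDiffOn ℝ ∞ α V) :
    ContDiffOn ℝ ∞ (fun z : E × ℝ => z.2 ^ p • Λ (α (x₀ + z.2 • (z.1 - x₀))) (z.1 - x₀))
      ((fun z : E × ℝ => x₀ + z.2 • (z.1 - x₀)) ⁻¹' V) := by
  have h1 : ContDiffOn ℝ ∞ (fun z : E × ℝ => α (x₀ + z.2 • (z.1 - x₀)))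
      ((fun z : E × ℝ => x₀ + z.2 • (z.1 - x₀)) ⁻¹' V) :=
    hα.comp (by fun_prop) (fun _ hz => hz)
  exact (by fun_prop : ContDiffOn ℝ ∞ (fun z : E × ℝ => z.2 ^ p) _).smul
    ((Λ.contDiff.comp_contDiffOn h1).clm_apply (g := fun z : E × ℝ => z.1 - x₀) (by fun_prop))

theorem contDiffOn_integral_radial [FiniteDimensional ℝ E] (Λ : X →L[ℝ] E →L[ℝ] Y) (p : ℕ)
    {α : E → X} (hV : IsOpen V) (hVx : StarConvex ℝ x₀ V) (hα : ContDiffOn ℝ ∞ α V) :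
    ContDiffOn ℝ ∞
      (fun x => ∫ t in (0 : ℝ)..1, t ^ p • Λ (α (x₀ + t • (x - x₀))) (x - x₀)) V :=
  contDiffOn_intervalIntegral (hV.preimage (by fun_prop)) (contDiffOn_radial_integrand Λ p hα) hV
    fun _ hx _ ht => hVx.segment_mem hx ht

theorem continuousOn_radial_fderiv (Λ : X →L[ℝ] E →L[ℝ] Y) (p : ℕ) {α : E → X} (hV : IsOpen V)
    (hVx : StarConvex ℝ x₀ V) (hα : ContDiffOn ℝ ∞ α V) (hx : x ∈ V) :
    ContinuousOn (fun t : ℝ => t ^ p • (Λ (α (x₀ + t • (x - x₀)))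
      + t • (Λ.comp (fderiv ℝ α (x₀ + t • (x - x₀)))).flip (x - x₀))) (Set.Icc 0 1) := by
  have h1 : ContinuousOn (fun t => (Λ.comp (fderiv ℝ α (x₀ + t • (x - x₀)))).flip)
      (Set.Icc (0 : ℝ) 1) :=
    (ContinuousLinearMap.flipₗᵢ ℝ E E Y).continuous.comp_continuousOn
      (continuousOn_const.clm_comp (hα.continuousOn_fderiv_segment hV hVx hx))
  exact (continuousOn_pow p).smul
    ((Λ.continuous.comp_continuousOn (hα.continuousOn.comp_segment hVx hx)).add
      (continuousOn_id.smul (h1.clm_apply continuousOn_const)))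

/-- The derivative of `x ↦ ∫₀¹ tᵖ Λ (α (x₀ + t (x - x₀))) (x - x₀) dt`, by the product rule under
the integral sign. -/
theorem hasFDerivAt_integral_radial [FiniteDimensional ℝ E] (Λ : X →L[ℝ] E →L[ℝ] Y) (p : ℕ)
    {α : E → X} (hV : IsOpen V) (hVx : StarConvex ℝ x₀ V) (hα : ContDiffOn ℝ ∞ α V) (hx : x ∈ V) :
    HasFDerivAt (fun x => ∫ t in (0 : ℝ)..1, t ^ p • Λ (α (x₀ + t • (x - x₀))) (x - x₀))
      (∫ t in (0 : ℝ)..1, t ^ p • (Λ (α (x₀ + t • (x - x₀)))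
        + t • (Λ.comp (fderiv ℝ α (x₀ + t • (x - x₀)))).flip (x - x₀))) x := by
  have hW : IsOpen ((fun z : E × ℝ => x₀ + z.2 • (z.1 - x₀)) ⁻¹' V) :=
    hV.preimage (by fun_prop)
  have h1 := hasFDerivAt_intervalIntegral_of_contDiffOn hW
    (contDiffOn_radial_integrand Λ p hα) (x := x) fun t ht => hVx.segment_mem hx ht
  refine h1.congr_fderiv ?_
  refine intervalIntegral.integral_congr (E := E →L[ℝ] Y) fun t ht => ?_
  rw [Set.uIcc_of_le zero_le_one] at ht
  have h2 := ((contDiffOn_radial_integrand (x₀ := x₀) Λ p hα).contDiffAt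
    (hW.mem_nhds (show (x, t) ∈ _ from hVx.segment_mem hx ht))).differentiableAt (by simp)
  have h2 := HasFDerivAt.comp (f := fun z : E => (z, t)) x h2.hasFDerivAt
    (hasFDerivAt_prodMk_left (𝕜 := ℝ) x t)
  have h3 : HasFDerivAt (fun z : E => x₀ + t • (z - x₀)) (t • ContinuousLinearMap.id ℝ E) x :=
    (((hasFDerivAt_id x).sub_const x₀).const_smul t).const_add x₀
  have h4 : HasFDerivAt (fun z => Λ (α (x₀ + t • (z - x₀))))
      (Λ.comp ((fderiv ℝ α (x₀ + t • (x - x₀))).comp (t • ContinuousLinearMap.id ℝ E))) x :=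
    Λ.hasFDerivAt.comp x
      (HasFDerivAt.comp x (hα.differentiableAt_segment hV hVx hx ht).hasFDerivAt h3)
  have h5 := (h4.clm_apply ((hasFDerivAt_id x).sub_const x₀)).const_smul (t ^ p)
  refine HasFDerivAt.unique h2 (h5.congr_fderiv ?_)
  ext u
  simp

end Segment

/-! ### The homotopy operator of the Poincaré lemma -/

section Poincare

universe u

variable {E F : Type u} [NormedAddCommGroup E] [NormedSpace ℝ E]
  [NormedAddCommGroup F] [NormedSpace ℝ F] {p : ℕ}

open ContinuousAlternatingMap

/-- The pointwise form of Cartan's formula for contraction with a constant vector `h`: if `A` is the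
derivative of a form, then `B` is the derivative of its contraction with `h`, and the right-hand side
is its derivative in the direction `h`. -/
theorem alternatizeUncurryFin_add_curryLeft_alternatizeUncurryFin
    (A : E →L[ℝ] E [⋀^Fin (p + 1)]→L[ℝ] F) (B : E →L[ℝ] E [⋀^Fin p]→L[ℝ] F) (h : E)
    (hB : ∀ u, B u = (A u).curryLeft h) :
    alternatizeUncurryFin B + (alternatizeUncurryFin A).curryLeft h = A h := by
  ext v
  simp only [ContinuousAlternatingMap.add_apply, alternatizeUncurryFin_apply, hB,
    curryLeft_apply_apply]
  rw [Fin.sum_univ_succ (n := p + 1)]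
  have : ∀ i : Fin (p + 1), Fin.removeNth i.succ (Matrix.vecCons h v)
      = Matrix.vecCons h (Fin.removeNth i v) := by
    intro i
    ext j
    cases j using Fin.cases <;> simp [Fin.removeNth]
  simp only [this, Fin.val_succ, pow_succ, mul_neg, mul_one, neg_smul, Matrix.cons_val_succ,
    Finset.sum_neg_distrib, Fin.val_zero, pow_zero, one_smul, Matrix.cons_val_zero]
  have h0 : Fin.removeNth 0 (Matrix.vecCons h v) = v := by
    ext j; simp [Fin.removeNth]
  rw [h0]
  abel

theorem curryLeft_alternatizeUncurryFin_zero (A : E →L[ℝ] E [⋀^Fin 0]→L[ℝ] F) (h : E) :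
    (alternatizeUncurryFin A).curryLeft h = A h := by
  ext v
  simp [alternatizeUncurryFin_apply]

/-- The homotopy operator of the Poincaré lemma for the contraction to `x₀` along straight lines:
`(K α)(x) = ∫₀¹ tᵖ ι_{x - x₀} α(x₀ + t (x - x₀)) dt`, where `ι` is the contraction with the first
argument. It sends `(p + 1)`-forms to `p`-forms. -/
def radialHomotopy (x₀ : E) (α : E → E [⋀^Fin (p + 1)]→L[ℝ] F) (x : E) : E [⋀^Fin p]→L[ℝ] F :=
  ∫ t in (0 : ℝ)..1, t ^ p • (α (x₀ + t • (x - x₀))).curryLeft (x - x₀)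

variable {V : Set E} {x₀ x : E}

theorem contDiffOn_radialHomotopy [FiniteDimensional ℝ E] (hV : IsOpen V) (hVx : StarConvex ℝ x₀ V)
    {α : E → E [⋀^Fin (p + 1)]→L[ℝ] F} (hα : ContDiffOn ℝ ∞ α V) :
    ContDiffOn ℝ ∞ (radialHomotopy x₀ α) V :=
  contDiffOn_integral_radial (X := E [⋀^Fin (p + 1)]→L[ℝ] F) (Y := E [⋀^Fin p]→L[ℝ] F)
    curryLeftLI.toContinuousLinearMap p hV hVx hα

/-- The homotopy formula in degree `0`. -/
theorem radialHomotopy_extDeriv_zero [CompleteSpace F] (hV : IsOpen V)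
    (hVx : StarConvex ℝ x₀ V) {α : E → E [⋀^Fin 0]→L[ℝ] F} (hα : ContDiffOn ℝ ∞ α V) (hx : x ∈ V) :
    radialHomotopy x₀ (extDeriv α) x = α x - α x₀ := by
  simp only [radialHomotopy, extDeriv, curryLeft_alternatizeUncurryFin_zero, pow_zero, one_smul]
  exact integral_fderiv_segment hV hVx hα hx

/-- The homotopy formula `d K α + K d α = α` in positive degree. -/
theorem extDeriv_radialHomotopy [FiniteDimensional ℝ E] [CompleteSpace F] (hV : IsOpen V)
    (hVx : StarConvex ℝ x₀ V) {α : E → E [⋀^Fin (p + 1)]→L[ℝ] F} (hα : ContDiffOn ℝ ∞ α V)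
    (hx : x ∈ V) :
    extDeriv (radialHomotopy x₀ α) x + radialHomotopy x₀ (extDeriv α) x = α x := by
  let Λ : (E [⋀^Fin (p + 1)]→L[ℝ] F) →L[ℝ] E →L[ℝ] E [⋀^Fin p]→L[ℝ] F :=
    curryLeftLI.toContinuousLinearMap
  have hderiv := hasFDerivAt_integral_radial (X := E [⋀^Fin (p + 1)]→L[ℝ] F)
    (Y := E [⋀^Fin p]→L[ℝ] F) Λ p hV hVx hα hx
  have hcg := continuousOn_radial_fderiv (X := E [⋀^Fin (p + 1)]→L[ℝ] F)
    (Y := E [⋀^Fin p]→L[ℝ] F) Λ p hV hVx hα hx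
  have h5 : extDeriv (radialHomotopy x₀ α) x = ∫ t in (0 : ℝ)..1, alternatizeUncurryFin
      (t ^ p • (Λ (α (x₀ + t • (x - x₀)))
        + t • (Λ.comp (fderiv ℝ α (x₀ + t • (x - x₀)))).flip (x - x₀))) :=
    (congrArg alternatizeUncurryFin hderiv.fderiv).trans
      (ContinuousLinearMap.intervalIntegral_comp_comm (𝕜 := ℝ)
        (E := E →L[ℝ] E [⋀^Fin p]→L[ℝ] F) (F := E [⋀^Fin (p + 1)]→L[ℝ] F)
        (alternatizeUncurryFinCLM ℝ E F (n := p)) hcg.intervalIntegrable_zero_one).symm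
  have hce : ContinuousOn (fun t : ℝ => (extDeriv α (x₀ + t • (x - x₀))).curryLeft (x - x₀))
      (Set.Icc 0 1) := by
    have := (curryLeftLI (𝕜 := ℝ) (E := E) (F := F) (n := p + 1)).continuous.comp_continuousOn
      ((alternatizeUncurryFinCLM ℝ E F (n := p + 1)).continuous.comp_continuousOn
        (hα.continuousOn_fderiv_segment hV hVx hx))
    exact this.clm_apply continuousOn_const
  rw [h5, radialHomotopy, ← intervalIntegral.integral_add]
  · rw [← integral_deriv_pow_smul_segment hV hVx hα hx p]
    refine intervalIntegral.integral_congr (E := E [⋀^Fin (p + 1)]→L[ℝ] F) fun t _ => ?_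
    have e1 := alternatizeUncurryFin_add_curryLeft_alternatizeUncurryFin
      (fderiv ℝ α (x₀ + t • (x - x₀))) ((Λ.comp (fderiv ℝ α (x₀ + t • (x - x₀)))).flip (x - x₀))
      (x - x₀) (fun u => rfl)
    have e2 : Λ (α (x₀ + t • (x - x₀))) = curryLeft (α (x₀ + t • (x - x₀))) := rfl
    simp only [← e1, extDeriv, e2, alternatizeUncurryFin_smul, alternatizeUncurryFin_add,
      alternatizeUncurryFin_curryLeft]
    module
  · exact ((alternatizeUncurryFinCLM ℝ E F (n := p)).continuous.comp_continuousOn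
      hcg).intervalIntegrable_zero_one
  · exact ((continuousOn_pow _).smul hce).intervalIntegrable_zero_one

end Poincare

/-! ### Finite dimension modulo a subspace -/

section LinearAlgebra

variable {K : Type*} [Field K]

/-- If `f Z` is finite-dimensional modulo `B'`, and the part of `Z` that `f` sends into `B'` is
finite-dimensional modulo `B`, then `Z` is finite-dimensional modulo `B`. -/
theorem Submodule.exists_fg_le_sup_of_map_of_comap {M M' : Type*} [AddCommGroup M] [Module K M]
    [AddCommGroup M'] [Module K M'] (f : M →ₗ[K] M') {Z B : Submodule K M} {B' : Submodule K M'}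
    (h' : ∃ S : Submodule K M', S.FG ∧ Z.map f ≤ B' ⊔ S)
    (h : ∃ S : Submodule K M, S.FG ∧ Z ⊓ B'.comap f ≤ B ⊔ S) :
    ∃ S : Submodule K M, S.FG ∧ Z ≤ B ⊔ S := by
  obtain ⟨S', hS', hZS'⟩ := h'
  obtain ⟨S, hS, hZS⟩ := h
  have h1 : (Z.map (B'.mkQ ∘ₗ f)).FG := by
    refine (hS'.map B'.mkQ).of_le ?_
    rw [Submodule.map_comp]
    exact (Submodule.map_mono hZS').trans (by simp [Submodule.map_sup])
  obtain ⟨t, ht⟩ := h1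
  have h2 : ∀ y ∈ (t : Set (M' ⧸ B')), ∃ x ∈ Z, (B'.mkQ ∘ₗ f) x = y := fun y hy =>
    (Submodule.mem_map.1 (ht ▸ Submodule.subset_span hy))
  choose! g hgZ hg using h2
  refine ⟨S ⊔ Submodule.span K (g '' t), hS.sup (Submodule.fg_span (t.finite_toSet.image g)), ?_⟩
  intro z hz
  have h3 : (B'.mkQ ∘ₗ f) z ∈ (Submodule.span K (g '' t)).map (B'.mkQ ∘ₗ f) := by
    rw [Submodule.map_span, ← Set.image_comp]
    have : ((B'.mkQ ∘ₗ f) ∘ g) '' t = t := by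
      refine (Set.image_congr fun y hy => hg y hy).trans (Set.image_id _)
    rw [this, ht]
    exact Submodule.mem_map_of_mem hz
  obtain ⟨w, hw, hwz⟩ := Submodule.mem_map.1 h3
  have hwZ : w ∈ Z := by
    refine (Submodule.span_le.2 ?_) hw
    rintro _ ⟨y, hy, rfl⟩
    exact hgZ y hy
  have h4 : z - w ∈ Z ⊓ B'.comap f := by
    refine Submodule.mem_inf.2 ⟨Z.sub_mem hz hwZ, ?_⟩
    rw [Submodule.mem_comap, ← B'.ker_mkQ, LinearMap.mem_ker]
    have : (B'.mkQ ∘ₗ f) (z - w) = 0 := by rw [map_sub, hwz, sub_self]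
    exact this
  have h5 := Submodule.add_mem_sup (hZS h4) hw
  rwa [sub_add_cancel, sup_assoc] at h5

/-- The part of the long exact cohomology sequence of `0 → X → Y → Z → 0` that involves the
connecting homomorphism `H⁰(Z) → H¹(X)`: if the cocycles of `Z₀` are finite-dimensional modulo a
subspace `B` of images of cocycles of `Y₀`, then the elements of `X₁` that become exact in `Y₁` are
finite-dimensional modulo the exact ones. -/
theorem LinearMap.exists_fg_comap_range_le_sup
    {X₀ X₁ Y₀ Y₁ Z₀ Z₁ : Type*} [AddCommGroup X₀] [Module K X₀] [AddCommGroup X₁] [Module K X₁]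
    [AddCommGroup Y₀] [Module K Y₀] [AddCommGroup Y₁] [Module K Y₁] [AddCommGroup Z₀] [Module K Z₀]
    [AddCommGroup Z₁] [Module K Z₁]
    (dX : X₀ →ₗ[K] X₁) (dY : Y₀ →ₗ[K] Y₁) (dZ : Z₀ →ₗ[K] Z₁)
    (i₀ : X₀ →ₗ[K] Y₀) (i₁ : X₁ →ₗ[K] Y₁) (j₀ : Y₀ →ₗ[K] Z₀) (j₁ : Y₁ →ₗ[K] Z₁)
    (hi : ∀ x, i₁ (dX x) = dY (i₀ x)) (hj : ∀ y, j₁ (dY y) = dZ (j₀ y))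
    (hji : ∀ x, j₁ (i₁ x) = 0) (hinj : Function.Injective i₁)
    (hex : ∀ y, j₀ y = 0 → ∃ x, i₀ x = y) (hsurj : Function.Surjective j₀)
    {B : Submodule K Z₀} (hB : ∀ b ∈ B, ∃ y, dY y = 0 ∧ j₀ y = b)
    (h : ∃ S : Submodule K Z₀, S.FG ∧ LinearMap.ker dZ ≤ B ⊔ S) :
    ∃ S : Submodule K X₁, S.FG ∧ (LinearMap.range dY).comap i₁ ≤ LinearMap.range dX ⊔ S := by
  obtain ⟨S, hS, hle⟩ := h
  obtain ⟨s, hs⟩ := j₀.exists_rightInverse_of_surjective (LinearMap.range_eq_top.2 hsurj)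
  have hs' : ∀ z, j₀ (s z) = z := fun z => LinearMap.congr_fun hs z
  -- The connecting homomorphism sends `γ` to the element of `X₁` with image `dY (s γ)` under `i₁`.
  refine ⟨(S.map (dY ∘ₗ s)).comap i₁, ?_, ?_⟩
  · exact Submodule.fg_of_fg_map_injective i₁ hinj
      ((hS.map (dY ∘ₗ s)).of_le (Submodule.map_comap_le _ _))
  · rintro x ⟨y, hy⟩
    have h1 : j₀ y ∈ LinearMap.ker dZ := by
      rw [LinearMap.mem_ker, ← hj, hy, hji]
    obtain ⟨b, hb, γ, hγ, hbγ⟩ := Submodule.mem_sup.1 (hle h1)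
    obtain ⟨y', hy', rfl⟩ := hB b hb
    obtain ⟨w, hw⟩ := hex (y - y' - s γ) (by simp [hs', ← hbγ])
    refine Submodule.mem_sup.2 ⟨dX w, ⟨w, rfl⟩, x - dX w, ?_, by simp⟩
    refine ⟨γ, hγ, ?_⟩
    simp [hi, hw, hy', hy]

theorem Submodule.finite_quotient_submoduleOf {M : Type*} [AddCommGroup M] [Module K M]
    {Z B : Submodule K M} (h : ∃ S : Submodule K M, S.FG ∧ Z ≤ B ⊔ S) :
    Module.Finite K (Z ⧸ B.submoduleOf Z) := by
  obtain ⟨S, hS, hle⟩ := h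
  have h1 : Module.Finite K (Z.map B.mkQ) := Module.Finite.iff_fg.2 <| (hS.map B.mkQ).of_le <|
    (Submodule.map_mono hle).trans (by simp [Submodule.map_sup])
  refine Module.Finite.of_injective (N := Z.map B.mkQ)
    ((B.submoduleOf Z).liftQ (B.mkQ.submoduleMap Z) ?_) ?_
  · intro z hz
    rw [LinearMap.mem_ker]
    ext1
    exact (Submodule.Quotient.mk_eq_zero _).2 hz
  · rw [← LinearMap.ker_eq_bot, Submodule.ker_liftQ_eq_bot']
    ext z
    rw [LinearMap.mem_ker, ← Subtype.coe_inj]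
    exact (Submodule.Quotient.mk_eq_zero B).symm

end LinearAlgebra

/-! ### The Mayer–Vietoris sequence of superforms -/

namespace PolyhedralComplex

variable {E : Type*} [NormedAddCommGroup E] [NormedSpace ℝ E] {C : PolyhedralComplex E} {p q : ℕ}
  {U W Ω Ω' : TopologicalSpace.Opens C.support}

/-- Being a representative of a superform on `Ω` is a condition on germs at the points of `Ω`. The
condition at a point requires smoothness on a whole neighbourhood, because `ContDiffAt ℝ ∞` at a
single point lets the neighbourhood shrink with the order of differentiability. -/
theorem mem_representatives_iff {α : E → SuperformValue E p q} :
    α ∈ C.representatives p q Ω ↔ ∀ x ∈ Ω, ∀ᶠ y in 𝓝 (x : E), ContDiffAt ℝ ∞ α y := by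
  constructor
  · rintro ⟨V, hV, hVΩ, hα⟩ x hx
    filter_upwards [hV.mem_nhds (mem_open_of_mem hVΩ hx)] with y hy
    exact hα.contDiffAt (hV.mem_nhds hy)
  · intro h
    obtain ⟨V, hV, hVΩ⟩ := isOpen_induced_iff.1 Ω.isOpen
    refine ⟨V ∩ {x | ∀ᶠ y in 𝓝 x, ContDiffAt ℝ ∞ α y}, hV.inter isOpen_setOfPred_eventually_nhds,
      ?_, fun x hx => hx.2.self_of_nhds.contDiffWithinAt⟩
    rw [Set.preimage_inter, hVΩ, Set.inter_eq_left]
    exact fun x hx => h x hx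

theorem representatives_mono (h : Ω' ≤ Ω) :
    C.representatives p q Ω ≤ C.representatives p q Ω' := fun _ hα =>
  mem_representatives_iff.2 fun x hx => mem_representatives_iff.1 hα x (h hx)

theorem vanishing_mono (h : Ω' ≤ Ω) : C.vanishing p q Ω ≤ C.vanishing p q Ω' :=
  fun _ hα x hx => hα x (h hx)

/-- The restriction of superforms to a smaller open subset; on representatives it is the identity,
since these are functions on all of `E`. -/
def restrict (h : Ω' ≤ Ω) : C.Superform p q Ω →ₗ[ℝ] C.Superform p q Ω' :=
  Submodule.mapQ _ _ (Submodule.inclusion (representatives_mono h))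
    fun _ hα => vanishing_mono h hα

/-- The superform on `Ω` with a given representative. -/
def superformMk (α : E → SuperformValue E p q) (hα : α ∈ C.representatives p q Ω) :
    C.Superform p q Ω := Submodule.Quotient.mk ⟨α, hα⟩

theorem exists_superformMk (a : C.Superform p q Ω) :
    ∃ α, ∃ hα : α ∈ C.representatives p q Ω, superformMk α hα = a := by
  obtain ⟨⟨α, hα⟩, rfl⟩ := Submodule.Quotient.mk_surjective _ a
  exact ⟨α, hα, rfl⟩

theorem superformMk_eq_zero_iff {α : E → SuperformValue E p q}
    {hα : α ∈ C.representatives p q Ω} :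
    superformMk α hα = 0 ↔ α ∈ C.vanishing p q Ω :=
  Submodule.Quotient.mk_eq_zero _

theorem superformMk_eq_iff {α β : E → SuperformValue E p q}
    {hα : α ∈ C.representatives p q Ω} {hβ : β ∈ C.representatives p q Ω} :
    superformMk α hα = superformMk β hβ ↔ α - β ∈ C.vanishing p q Ω :=
  Submodule.Quotient.eq _

theorem restrict_superformMk (h : Ω' ≤ Ω) {α : E → SuperformValue E p q}
    (hα : α ∈ C.representatives p q Ω) :
    restrict h (superformMk α hα) = superformMk α (representatives_mono h hα) := rfl

theorem dPrime_restrict (h : Ω' ≤ Ω) (a : C.Superform p q Ω) :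
    C.dPrime p q Ω' (restrict h a) = restrict h (C.dPrime p q Ω a) := by
  obtain ⟨α, hα, rfl⟩ := exists_superformMk a
  rfl

/-- A partition of unity `φ, 1 - φ` subordinate to the cover of `U ⊔ W` by `U` and `W`: the function
`φ` is smooth near `U ⊔ W`, it vanishes near the points outside `U` and is `1` near those
outside `W`. -/
theorem exists_cutoff [FiniteDimensional ℝ E] (U W : TopologicalSpace.Opens C.support) :
    ∃ φ : E → ℝ, (∀ x ∈ U ⊔ W, ∀ᶠ y in 𝓝 (x : E), ContDiffAt ℝ ∞ φ y) ∧
      (∀ x ∈ W, x ∉ U → φ =ᶠ[𝓝 (x : E)] 0) ∧ (∀ x ∈ U, x ∉ W → φ =ᶠ[𝓝 (x : E)] 1) := by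
  obtain ⟨V₁, hV₁, hU⟩ := isOpen_induced_iff.1 U.isOpen
  obtain ⟨V₂, hV₂, hW⟩ := isOpen_induced_iff.1 W.isOpen
  obtain ⟨f₁, hs₁, hf₁, hr₁⟩ := hV₁.exists_contDiff_support_eq (n := ⊤)
  obtain ⟨f₂, hs₂, hf₂, hr₂⟩ := hV₂.exists_contDiff_support_eq (n := ⊤)
  have hn₁ : ∀ x, 0 ≤ f₁ x := fun x => (hr₁ ⟨x, rfl⟩).1
  have hn₂ : ∀ x, 0 ≤ f₂ x := fun x => (hr₂ ⟨x, rfl⟩).1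
  have hU' : ∀ x : C.support, x ∈ U ↔ f₁ x ≠ 0 := fun x => by
    rw [← Function.mem_support, hs₁, ← SetLike.mem_coe, ← hU]; rfl
  have hW' : ∀ x : C.support, x ∈ W ↔ f₂ x ≠ 0 := fun x => by
    rw [← Function.mem_support, hs₂, ← SetLike.mem_coe, ← hW]; rfl
  have hpos : ∀ x ∈ U ⊔ W, 0 < f₁ (x : E) + f₂ x := by
    rintro x (hx | hx)
    · exact add_pos_of_pos_of_nonneg ((hn₁ x).lt_of_ne' ((hU' x).1 hx)) (hn₂ x)
    · exact add_pos_of_nonneg_of_pos (hn₁ x) ((hn₂ x).lt_of_ne' ((hW' x).1 hx))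
  have hsm : ∀ y, 0 < f₁ y + f₂ y → ContDiffAt ℝ ∞ (fun x => 3 * (f₁ x / (f₁ x + f₂ x)) - 1) y :=
    fun y hy => (contDiffAt_const.mul
      (hf₁.contDiffAt.div (hf₁.contDiffAt.add hf₂.contDiffAt) hy.ne')).sub contDiffAt_const
  -- The ratio `f₁ / (f₁ + f₂)` is `0` off `U` and `1` off `W`; the smooth step from `1/3` to `2/3`
  -- makes it constant near these points.
  refine ⟨fun x => Real.smoothTransition (3 * (f₁ x / (f₁ x + f₂ x)) - 1), ?_, ?_, ?_⟩
  · intro x hx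
    filter_upwards [(hf₁.continuous.add hf₂.continuous).continuousAt.eventually_const_lt
      (hpos x hx)] with y hy
    exact Real.smoothTransition.contDiff.contDiffAt.comp y (hsm y hy)
  · intro x hx hxU
    have h0 : f₁ x = 0 := by simpa using mt (hU' x).2 hxU
    filter_upwards [(hsm x (hpos x (Or.inr hx))).continuousAt.eventually_lt_const
      (show 3 * (f₁ x / (f₁ x + f₂ x)) - 1 < 0 by simp [h0])] with y hy
    exact Real.smoothTransition.zero_of_nonpos hy.le
  · intro x hx hxW
    have h0 : f₂ x = 0 := by simpa using mt (hW' x).2 hxW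
    filter_upwards [(hsm x (hpos x (Or.inl hx))).continuousAt.eventually_const_lt
      (show 1 < 3 * (f₁ x / (f₁ x + f₂ x)) - 1 by
        rw [h0, add_zero, div_self ((hU' x).1 hx)]; norm_num)] with y hy
    exact Real.smoothTransition.one_of_one_le hy.le

theorem eventually_contDiffAt_congr {F : Type*} [NormedAddCommGroup F] [NormedSpace ℝ F]
    {f g : E → F} {x : E} (hg : ∀ᶠ y in 𝓝 x, ContDiffAt ℝ ∞ g y) (hfg : f =ᶠ[𝓝 x] g) :
    ∀ᶠ y in 𝓝 x, ContDiffAt ℝ ∞ f y := by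
  filter_upwards [hg, hfg.eventually_nhds] with y h1 h2
  exact h1.congr_of_eventuallyEq h2

/-- A superform on `U ⊔ W` is determined by its restrictions to `U` and `W`. -/
theorem restrict_injective_prod :
    Function.Injective ((restrict (p := p) (q := q) (le_sup_left : U ≤ U ⊔ W)).prod
      (restrict (le_sup_right : W ≤ U ⊔ W))) := by
  rw [← LinearMap.ker_eq_bot, LinearMap.ker_eq_bot']
  intro a ha
  obtain ⟨α, hα, rfl⟩ := exists_superformMk a
  obtain ⟨h1, h2⟩ := Prod.mk_eq_zero.1 ha
  rw [restrict_superformMk, superformMk_eq_zero_iff] at h1 h2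
  rw [superformMk_eq_zero_iff]
  rintro x (hx | hx)
  · exact h1 x hx
  · exact h2 x hx

/-- Superforms on `U` and `W` that agree on `U ⊓ W` glue to a superform on `U ⊔ W`. -/
theorem exists_glue [FiniteDimensional ℝ E] (a : C.Superform p q U) (b : C.Superform p q W)
    (hab : restrict (inf_le_left : U ⊓ W ≤ U) a = restrict (inf_le_right : U ⊓ W ≤ W) b) :
    ∃ c : C.Superform p q (U ⊔ W), restrict le_sup_left c = a ∧ restrict le_sup_right c = b := by
  obtain ⟨α, hα, rfl⟩ := exists_superformMk a
  obtain ⟨β, hβ, rfl⟩ := exists_superformMk b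
  rw [restrict_superformMk, restrict_superformMk, superformMk_eq_iff] at hab
  obtain ⟨φ, hφ, hφ0, hφ1⟩ := exists_cutoff U W
  rw [mem_representatives_iff] at hα hβ
  have hω : (fun x => φ x • α x + (1 - φ x) • β x) ∈ C.representatives p q (U ⊔ W) := by
    rw [mem_representatives_iff]
    intro x hx
    by_cases hxU : x ∈ U
    · by_cases hxW : x ∈ W
      · filter_upwards [hφ x hx, hα x hxU, hβ x hxW] with y h1 h2 h3
        exact (h1.smul h2).add ((contDiffAt_const.sub h1).smul h3)
      · refine eventually_contDiffAt_congr (hα x hxU) ?_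
        filter_upwards [hφ1 x hxU hxW] with y hy
        simp [hy]
    · have hxW : x ∈ W := hx.resolve_left hxU
      refine eventually_contDiffAt_congr (hβ x hxW) ?_
      filter_upwards [hφ0 x hxW hxU] with y hy
      simp [hy]
  refine ⟨superformMk _ hω, ?_, ?_⟩
  · rw [restrict_superformMk, superformMk_eq_iff]
    intro x hx σ hσ hxσ v hv w hw
    by_cases hxW : x ∈ W
    · have := hab x ⟨hx, hxW⟩ σ hσ hxσ v hv w hw
      have e : ((fun x => φ x • α x + (1 - φ x) • β x) - α) (x : E)
          = (-(1 - φ x)) • (α - β) (x : E) := by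
        simp only [Pi.sub_apply]; module
      rw [e]
      simp only [ContinuousAlternatingMap.smul_apply, ConstForm.smul_apply, this, mul_zero]
    · simp [(hφ1 x hx hxW).self_of_nhds]
  · rw [restrict_superformMk, superformMk_eq_iff]
    intro x hx σ hσ hxσ v hv w hw
    by_cases hxU : x ∈ U
    · have := hab x ⟨hxU, hx⟩ σ hσ hxσ v hv w hw
      have e : ((fun x => φ x • α x + (1 - φ x) • β x) - β) (x : E)
          = φ x • (α - β) (x : E) := by
        simp only [Pi.sub_apply]; module
      rw [e]
      simp only [ContinuousAlternatingMap.smul_apply, ConstForm.smul_apply, this, mul_zero]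
    · simp [(hφ0 x hx hxU).self_of_nhds]

/-- Every superform on `U ⊓ W` is a difference of superforms on `U` and `W`. -/
theorem exists_restrict_sub_restrict [FiniteDimensional ℝ E] (c : C.Superform p q (U ⊓ W)) :
    ∃ (a : C.Superform p q U) (b : C.Superform p q W),
      restrict inf_le_left a - restrict inf_le_right b = c := by
  obtain ⟨γ, hγ, rfl⟩ := exists_superformMk c
  obtain ⟨φ, hφ, hφ0, hφ1⟩ := exists_cutoff U W
  rw [mem_representatives_iff] at hγ
  have hα : (fun x => (1 - φ x) • γ x) ∈ C.representatives p q U := by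
    rw [mem_representatives_iff]
    intro x hx
    by_cases hxW : x ∈ W
    · filter_upwards [hφ x (Or.inl hx), hγ x ⟨hx, hxW⟩] with y h1 h2
      exact (contDiffAt_const.sub h1).smul h2
    · refine eventually_contDiffAt_congr
        (Filter.Eventually.of_forall fun y => contDiffAt_const (c := 0)) ?_
      filter_upwards [hφ1 x hx hxW] with y hy
      simp [hy]
  have hβ : (fun x => (-φ x) • γ x) ∈ C.representatives p q W := by
    rw [mem_representatives_iff]
    intro x hx
    by_cases hxU : x ∈ U
    · filter_upwards [hφ x (Or.inr hx), hγ x ⟨hxU, hx⟩] with y h1 h2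
      exact h1.neg.smul h2
    · refine eventually_contDiffAt_congr
        (Filter.Eventually.of_forall fun y => contDiffAt_const (c := 0)) ?_
      filter_upwards [hφ0 x hx hxU] with y hy
      simp [hy]
  refine ⟨superformMk _ hα, superformMk _ hβ, ?_⟩
  rw [restrict_superformMk, restrict_superformMk]
  refine congrArg Submodule.Quotient.mk (Subtype.ext (funext fun x => ?_))
  change (1 - φ x) • γ x - (-φ x) • γ x = γ x
  module

variable (C p q Ω) in
/-- The closed superforms of bidegree `(p, q)` on `Ω` are finite-dimensional modulo the exact ones:
they lie in the sum of the exact forms and a finite-dimensional space, whose members need not be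
closed. -/
def FiniteModExact : Prop :=
  ∃ S : Submodule ℝ (C.Superform p q Ω), S.FG ∧ C.closedForms p q Ω ≤ C.exactForms q Ω p ⊔ S

theorem FiniteModExact.finiteDimensional (h : C.FiniteModExact p q Ω) :
    FiniteDimensional ℝ (C.Cohomology p q Ω) :=
  Submodule.finite_quotient_submoduleOf h

/-- Finiteness of cohomology passes to unions, by the Mayer–Vietoris sequence
`Hᵖ⁻¹(U ⊓ W) → Hᵖ(U ⊔ W) → Hᵖ(U) × Hᵖ(W)`. -/
theorem FiniteModExact.sup [FiniteDimensional ℝ E] (hU : C.FiniteModExact p q U)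
    (hW : C.FiniteModExact p q W)
    (hUW : ∀ p', p = p' + 1 → C.FiniteModExact p' q (U ⊓ W)) :
    C.FiniteModExact p q (U ⊔ W) := by
  let i : ∀ p, C.Superform p q (U ⊔ W) →ₗ[ℝ] C.Superform p q U × C.Superform p q W := fun p =>
    (restrict le_sup_left).prod (restrict le_sup_right)
  let j : ∀ p, C.Superform p q U × C.Superform p q W →ₗ[ℝ] C.Superform p q (U ⊓ W) := fun p =>
    restrict inf_le_left ∘ₗ LinearMap.fst ℝ _ _ - restrict inf_le_right ∘ₗ LinearMap.snd ℝ _ _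
  have hinj : ∀ p, Function.Injective (i p) := fun p => restrict_injective_prod
  refine Submodule.exists_fg_le_sup_of_map_of_comap (i p)
    (B' := (C.exactForms q U p).prod (C.exactForms q W p)) ?_ ?_
  · obtain ⟨S, hS, hSU⟩ := hU
    obtain ⟨T, hT, hTW⟩ := hW
    refine ⟨S.prod T, hS.prod hT, ?_⟩
    rw [Submodule.map_le_iff_le_comap, Submodule.prod_sup_prod]
    intro c hc
    refine ⟨hSU ?_, hTW ?_⟩
    all_goals
      change C.dPrime _ _ _ (restrict _ c) = 0
      rw [dPrime_restrict, (show C.dPrime _ _ _ c = 0 from hc), map_zero]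
  · cases p with
    | zero =>
      refine ⟨⊥, Submodule.fg_bot, ?_⟩
      rintro c ⟨-, h1, h2⟩
      have h3 : c = 0 := hinj 0 (Prod.ext (h1.trans (map_zero _).symm) (h2.trans (map_zero _).symm))
      simp [h3]
    | succ p =>
      suffices h : ∃ S : Submodule ℝ (C.Superform (p + 1) q (U ⊔ W)), S.FG ∧
          (LinearMap.range ((C.dPrime p q U).prodMap (C.dPrime p q W))).comap (i (p + 1))
            ≤ LinearMap.range (C.dPrime p q (U ⊔ W)) ⊔ S by
        obtain ⟨S, hS, hle⟩ := h
        refine ⟨S, hS, fun c hc => hle ?_⟩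
        obtain ⟨-, ⟨a, ha⟩, ⟨b, hb⟩⟩ := hc
        exact ⟨(a, b), Prod.ext ha hb⟩
      refine LinearMap.exists_fg_comap_range_le_sup
        (C.dPrime p q (U ⊔ W)) ((C.dPrime p q U).prodMap (C.dPrime p q W)) (C.dPrime p q (U ⊓ W))
        (i p) (i (p + 1)) (j p) (j (p + 1)) ?_ ?_ ?_ (hinj _) ?_ ?_ ?_ (hUW p rfl)
      · exact fun c => Prod.ext (dPrime_restrict _ c).symm (dPrime_restrict _ c).symm
      · rintro ⟨a, b⟩
        simp [j, dPrime_restrict]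
      · intro c
        obtain ⟨γ, hγ, rfl⟩ := exists_superformMk c
        exact sub_self (superformMk γ (representatives_mono inf_le_sup hγ))
      · rintro ⟨a, b⟩ hab
        obtain ⟨c, ha, hb⟩ := exists_glue a b (sub_eq_zero.1 hab)
        exact ⟨c, Prod.ext ha hb⟩
      · intro c
        obtain ⟨a, b, h⟩ := exists_restrict_sub_restrict c
        exact ⟨(a, b), h⟩
      · intro c hc
        cases p with
        | zero =>
          rw [(show c = 0 from hc)]
          exact ⟨0, map_zero _, map_zero _⟩
        | succ p =>
          obtain ⟨c, rfl⟩ := hc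
          obtain ⟨a, b, rfl⟩ := exists_restrict_sub_restrict c
          refine ⟨(C.dPrime p q U a, C.dPrime p q W b), ?_, ?_⟩
          · exact Prod.ext (dPrime_dPrime _ _ _ _ a) (dPrime_dPrime _ _ _ _ b)
          · simp [j, dPrime_restrict]

end PolyhedralComplex

/-! ### Open stars -/

theorem IsPolyhedron.isClosed {E : Type*} [NormedAddCommGroup E] [NormedSpace ℝ E] {σ : Set E}
    (hσ : IsPolyhedron σ) : IsClosed σ := by
  obtain ⟨m, u, c, rfl⟩ := hσ
  rw [Set.ofPred_forall]
  exact isClosed_iInter fun i => isClosed_le (u i).continuous continuous_const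

namespace PolyhedralComplex

universe u

variable {E : Type u} [NormedAddCommGroup E] [NormedSpace ℝ E] {C : PolyhedralComplex E} {p q : ℕ}

/-- Among the members containing a nonempty set `T` there is a smallest one. -/
theorem exists_least {T σ₀ : Set E} (hT : T.Nonempty) (hσ₀ : σ₀ ∈ C.polyhedra) (hTσ : T ⊆ σ₀) :
    ∃ ρ ∈ C.polyhedra, T ⊆ ρ ∧ ∀ σ ∈ C.polyhedra, T ⊆ σ → ρ ⊆ σ := by
  obtain ⟨ρ, ⟨hρ, hTρ⟩, hmin⟩ := (C.finite_polyhedra.subset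
    (Set.sep_subset C.polyhedra fun σ => T ⊆ σ)).exists_minimal ⟨σ₀, hσ₀, hTσ⟩
  refine ⟨ρ, hρ, hTρ, fun σ hσ hTσ => ?_⟩
  have hT' : T ⊆ ρ ∩ σ := Set.subset_inter hTρ hTσ
  exact (hmin ⟨C.face_mem ρ hρ _ (C.inter_face ρ hρ σ hσ).1 (hT.mono hT'), hT'⟩
    Set.inter_subset_left).trans Set.inter_subset_right

theorem isExtreme_inter {ρ σ : Set E} (hρ : ρ ∈ C.polyhedra) (hσ : σ ∈ C.polyhedra) :
    IsExtreme ℝ ρ (ρ ∩ σ) :=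
  (C.inter_face ρ hρ σ hσ).1.isExtreme

/-- A member `ρ` is not the union of finitely many proper faces, so some point of `ρ`, necessarily in
its relative interior, lies only in members that contain `ρ`. -/
theorem exists_generic_point {ρ : Set E} (hρ : ρ ∈ C.polyhedra) (hne : ρ.Nonempty) :
    ∃ x ∈ ρ, ∀ σ ∈ C.polyhedra, x ∈ σ → ρ ⊆ σ := by
  suffices h : ∀ S ⊆ {σ ∈ C.polyhedra | ¬ ρ ⊆ σ}, S.Finite → ∃ x ∈ ρ, ∀ σ ∈ S, x ∉ σ by
    obtain ⟨x, hx, h⟩ := h _ subset_rfl (C.finite_polyhedra.subset (Set.sep_subset _ _))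
    exact ⟨x, hx, fun σ hσ hxσ => by_contra fun hn => h σ ⟨hσ, hn⟩ hxσ⟩
  intro S hSsub hS
  induction S, hS using Set.Finite.induction_on with
  | empty =>
    obtain ⟨x, hx⟩ := hne
    exact ⟨x, hx, by simp⟩
  | @insert τ S _ _ ih =>
    obtain ⟨x, hx, hxS⟩ := ih ((Set.subset_insert τ S).trans hSsub)
    obtain ⟨y, hy, hyτ⟩ := Set.not_subset.1 (hSsub (Set.mem_insert τ S)).2
    -- An extreme set that contains the midpoint of `x` and `y` contains both `x` and `y`.
    have hm : midpoint ℝ x y ∈ openSegment ℝ x y := midpoint_mem_openSegment x y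
    refine ⟨midpoint ℝ x y, (C.isPolyhedron ρ hρ).convex.openSegment_subset hx hy hm, ?_⟩
    rintro σ (rfl | hσ) hmσ
    · exact hyτ ((C.isExtreme_inter hρ (hSsub (Set.mem_insert _ S)).1).right_mem_of_mem_openSegment
        hx hy ⟨(C.isPolyhedron ρ hρ).convex.openSegment_subset hx hy hm, hmσ⟩ hm).2
    · exact hxS σ hσ ((C.isExtreme_inter hρ
        (hSsub (Set.mem_insert_of_mem _ hσ)).1).left_mem_of_mem_openSegment
        hx hy ⟨(C.isPolyhedron ρ hρ).convex.openSegment_subset hx hy hm, hmσ⟩ hm).2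

variable (C) in
/-- The open star of a set `T`: the points of the support all of whose members contain `T`. For a
nonempty member `T`, it is the union of the relative interiors of the members containing `T`. -/
def openStar (T : Set E) : TopologicalSpace.Opens C.support where
  carrier := {x | ∀ σ ∈ C.polyhedra, (x : E) ∈ σ → T ⊆ σ}
  is_open' := by
    have h : IsClosed (⋃ σ ∈ {σ ∈ C.polyhedra | ¬ T ⊆ σ}, σ) :=
      (C.finite_polyhedra.subset (Set.sep_subset _ _)).isClosed_biUnion
        fun σ hσ => (C.isPolyhedron σ hσ.1).isClosed
    convert (h.preimage continuous_subtype_val).isOpen_compl using 1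
    ext x
    simp [not_imp_not]

theorem mem_openStar {T : Set E} {x : C.support} :
    x ∈ C.openStar T ↔ ∀ σ ∈ C.polyhedra, (x : E) ∈ σ → T ⊆ σ := Iff.rfl

theorem openStar_inf_openStar (T T' : Set E) :
    C.openStar T ⊓ C.openStar T' = C.openStar (T ∪ T') := by
  ext x
  simp only [TopologicalSpace.Opens.coe_inf, Set.mem_inter_iff, SetLike.mem_coe, mem_openStar,
    Set.union_subset_iff]
  exact ⟨fun h σ hσ hx => ⟨h.1 σ hσ hx, h.2 σ hσ hx⟩,
    fun h => ⟨fun σ hσ hx => (h σ hσ hx).1, fun σ hσ hx => (h σ hσ hx).2⟩⟩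

/-- An open subset `Ω` of the support is star-shaped about `x₀` in a way compatible with the
complex: `x₀` lies in all members that meet `Ω`, and `Ω` contains the segments from `x₀` to its
points. As `x₀` is a point of `E`, the points of these segments are given as `y : C.support` with a
prescribed value. -/
def IsStarShaped (Ω : TopologicalSpace.Opens C.support) (x₀ : E) : Prop :=
  (∀ x ∈ Ω, ∀ σ ∈ C.polyhedra, (x : E) ∈ σ → x₀ ∈ σ) ∧
    ∀ x ∈ Ω, ∀ t ∈ Set.Icc (0 : ℝ) 1, ∀ y : C.support,
      (y : E) = x₀ + t • ((x : E) - x₀) → y ∈ Ω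

variable {Ω : TopologicalSpace.Opens C.support} {x₀ : E}

variable (C) in
/-- The open star of `T` is star-shaped about any point in the relative interior of the smallest
member containing `T`. -/
theorem exists_isStarShaped_openStar {T σ₀ : Set E} (hT : T.Nonempty) (hσ₀ : σ₀ ∈ C.polyhedra)
    (hTσ : T ⊆ σ₀) :
    ∃ x₀ : E, C.IsStarShaped (C.openStar T) x₀ := by
  obtain ⟨ρ, hρ, hTρ, hmin⟩ := exists_least hT hσ₀ hTσ
  obtain ⟨x₀, hx₀, hgen⟩ := exists_generic_point hρ (hT.mono hTρ)
  have hcenter : ∀ x ∈ C.openStar T, ∀ σ ∈ C.polyhedra, (x : E) ∈ σ → x₀ ∈ σ :=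
    fun x hx σ hσ hxσ => hmin σ hσ (hx σ hσ hxσ) hx₀
  refine ⟨x₀, hcenter, fun x hx t ht y hy σ' hσ' hyσ' => ?_⟩
  rw [hy] at hyσ'
  rcases ht.1.eq_or_lt with rfl | ht0
  · rw [zero_smul, add_zero] at hyσ'
    exact hTρ.trans (hgen σ' hσ' hyσ')
  rcases ht.2.eq_or_lt with rfl | ht1
  · rw [one_smul, add_sub_cancel] at hyσ'
    exact hx σ' hσ' hyσ'
  obtain ⟨σ, hσ, hxσ⟩ := x.2
  have hx₀σ := hcenter x hx σ hσ hxσ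
  have hseg : x₀ + t • ((x : E) - x₀) ∈ openSegment ℝ x₀ x :=
    ⟨1 - t, t, by linarith, ht0, by ring, by module⟩
  exact hx σ' hσ' ((C.isExtreme_inter hσ hσ').right_mem_of_mem_openSegment hx₀σ hxσ
    ⟨(C.isPolyhedron σ hσ).convex.openSegment_subset hx₀σ hxσ hseg, hyσ'⟩ hseg).2

end PolyhedralComplex

/-! ### Cohomology of star-shaped sets -/

section FiniteDimensional

variable {E F : Type*} [NormedAddCommGroup E] [NormedSpace ℝ E] [FiniteDimensional ℝ E]
  [NormedAddCommGroup F] [NormedSpace ℝ F] [FiniteDimensional ℝ F]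

instance ContinuousAlternatingMap.finiteDimensional (n : ℕ) :
    FiniteDimensional ℝ (E [⋀^Fin n]→L[ℝ] F) :=
  let f : (E [⋀^Fin n]→L[ℝ] F) →ₗ[ℝ] MultilinearMap ℝ (fun _ : Fin n => E) F :=
    { toFun := fun f => f.toMultilinearMap
      map_add' := fun _ _ => rfl
      map_smul' := fun _ _ => rfl }
  Module.Finite.of_injective f
    fun _ _ h => ContinuousAlternatingMap.ext fun v => congrArg (fun g => g v) h

instance ConstForm.finiteDimensional (q : ℕ) : FiniteDimensional ℝ (ConstForm E q) :=
  inferInstanceAs (FiniteDimensional ℝ (E [⋀^Fin q]→L[ℝ] ℝ))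

instance ConstForm.completeSpace (q : ℕ) : CompleteSpace (ConstForm E q) :=
  FiniteDimensional.complete ℝ _

end FiniteDimensional

section Star

variable {E : Type*} [NormedAddCommGroup E] [NormedSpace ℝ E]

/-- The largest subset of `V` that is star-shaped about `x₀` is open. -/
theorem IsOpen.exists_starConvex_core {V : Set E} (hV : IsOpen V) (x₀ : E) :
    ∃ V' ⊆ V, IsOpen V' ∧ StarConvex ℝ x₀ V' ∧
      ∀ x, (∀ t ∈ Set.Icc (0 : ℝ) 1, x₀ + t • (x - x₀) ∈ V) → x ∈ V' := by
  refine ⟨{x | ∀ t ∈ Set.Icc (0 : ℝ) 1, x₀ + t • (x - x₀) ∈ V}, ?_, ?_, ?_, fun x hx => hx⟩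
  · intro x hx
    simpa using hx 1 (by simp)
  · refine isOpen_iff_eventually.2 fun x hx => ?_
    refine isCompact_Icc.eventually_forall_of_forall_eventually fun t ht => ?_
    have hc : Continuous fun z : E × ℝ => x₀ + z.2 • (z.1 - x₀) := by fun_prop
    exact hc.continuousAt.eventually (hV.mem_nhds (hx t ht))
  · intro x hx a b ha hb hab t ht
    have h1 : x₀ + t • (a • x₀ + b • x - x₀) = x₀ + (t * b) • (x - x₀) := by
      obtain rfl : a = 1 - b := by linarith
      module
    rw [h1]
    exact hx _ ⟨mul_nonneg ht.1 hb, mul_le_one₀ ht.2 hb (by linarith)⟩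

end Star

/-- The integrability of `g` is not needed: the integral of a non-integrable function is `0`. -/
theorem ContinuousLinearMap.map_intervalIntegral_eq_zero {X Y : Type*} [NormedAddCommGroup X]
    [NormedSpace ℝ X] [CompleteSpace X] [NormedAddCommGroup Y] [NormedSpace ℝ Y] [CompleteSpace Y]
    (L : X →L[ℝ] Y) {g : ℝ → X} (hg : ∀ t ∈ Set.Icc (0 : ℝ) 1, L (g t) = 0) :
    L (∫ t in (0 : ℝ)..1, g t) = 0 := by
  by_cases h : IntervalIntegrable g MeasureTheory.volume 0 1
  · rw [← L.intervalIntegral_comp_comm h]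
    refine (intervalIntegral.integral_congr (g := fun _ => 0) fun t ht => ?_).trans (by simp)
    rw [Set.uIcc_of_le zero_le_one] at ht
    exact hg t ht
  · rw [intervalIntegral.integral_undef h, map_zero]

namespace PolyhedralComplex

universe u

variable {E : Type u} [NormedAddCommGroup E] [NormedSpace ℝ E] {C : PolyhedralComplex E} {p q : ℕ}

variable {Ω : TopologicalSpace.Opens C.support} {x₀ : E}

theorem IsStarShaped.segment_mem_polyhedron (h : C.IsStarShaped Ω x₀) {x : C.support} (hx : x ∈ Ω)
    {σ : Set E} (hσ : σ ∈ C.polyhedra) (hxσ : (x : E) ∈ σ) {t : ℝ} (ht : t ∈ Set.Icc (0 : ℝ) 1) :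
    x₀ + t • ((x : E) - x₀) ∈ σ :=
  (C.isPolyhedron σ hσ).convex.add_smul_sub_mem (h.1 x hx σ hσ hxσ) hxσ ht

/-- A superform on a star-shaped set is represented on an open subset of `E` that is itself
star-shaped. -/
theorem IsStarShaped.exists_starConvex (h : C.IsStarShaped Ω x₀) {α : E → SuperformValue E p q}
    (hα : α ∈ C.representatives p q Ω) :
    ∃ V : Set E, IsOpen V ∧ StarConvex ℝ x₀ V ∧
      ((↑) : C.support → E) ⁻¹' V = (Ω : Set C.support) ∧ ContDiffOn ℝ ∞ α V := by
  obtain ⟨V, hV, hVΩ, hαV⟩ := hα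
  obtain ⟨V', hV'V, hV', hstar, hmem⟩ := hV.exists_starConvex_core x₀
  refine ⟨V', hV', hstar, ?_, hαV.mono hV'V⟩
  refine Set.Subset.antisymm ((Set.preimage_mono hV'V).trans hVΩ.subset) fun x hx => ?_
  refine hmem x fun t ht => ?_
  obtain ⟨σ, hσ, hxσ⟩ := x.2
  exact mem_open_of_mem hVΩ (h.2 x hx t ht
    ⟨_, σ, hσ, h.segment_mem_polyhedron hx hσ hxσ ht⟩ rfl)

/-- The homotopy operator is compatible with restriction to polyhedra: for `x ∈ σ`, the vector
`x - x₀` is tangent to `σ`, and the segment from `x₀` to `x` lies in `σ`. -/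
theorem IsStarShaped.radialHomotopy_mem_vanishing [FiniteDimensional ℝ E]
    (h : C.IsStarShaped Ω x₀) {α : E → SuperformValue E (p + 1) q}
    (hα : α ∈ C.vanishing (p + 1) q Ω) : radialHomotopy x₀ α ∈ C.vanishing p q Ω := by
  intro x hx σ hσ hxσ v hv w hw
  let L : SuperformValue E p q →L[ℝ] ℝ :=
    (ConstForm.evalCLM w).comp (ContinuousAlternatingMap.apply ℝ E (ConstForm E q) v)
  have := FiniteDimensional.complete ℝ (SuperformValue E p q)
  refine L.map_intervalIntegral_eq_zero fun t ht => ?_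
  have hy := h.segment_mem_polyhedron hx hσ hxσ ht
  have hvan := hα ⟨_, σ, hσ, hy⟩ (h.2 x hx t ht _ rfl) σ hσ hy
    (Matrix.vecCons ((x : E) - x₀) v) (Fin.cases
      (AffineSubspace.vsub_mem_direction (subset_affineSpan ℝ σ hxσ)
        (subset_affineSpan ℝ σ (h.1 x hx σ hσ hxσ))) hv) w hw
  rw [map_smul]
  exact (congrArg (t ^ p • ·) hvan).trans (smul_zero _)

/-- The Poincaré lemma: on a star-shaped set, closed forms of positive degree are exact, and closed
forms of degree `0` are represented by constant functions. -/
theorem IsStarShaped.finiteModExact [FiniteDimensional ℝ E] (h : C.IsStarShaped Ω x₀) :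
    C.FiniteModExact p q Ω := by
  cases p with
  | zero =>
    let ι : SuperformValue E 0 q →ₗ[ℝ] C.Superform 0 q Ω :=
      { toFun := fun a => superformMk (fun _ => a)
          (mem_representatives_iff.2 fun _ _ => Filter.Eventually.of_forall fun _ =>
            contDiffAt_const)
        map_add' := fun _ _ => rfl
        map_smul' := fun _ _ => rfl }
    refine ⟨LinearMap.range ι, Module.Finite.iff_fg.1 inferInstance, fun a ha => ?_⟩
    refine Submodule.mem_sup_right ?_
    obtain ⟨α, hα, rfl⟩ := exists_superformMk a
    obtain ⟨V, hV, hVx, hVΩ, hαV⟩ := h.exists_starConvex hα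
    refine ⟨α x₀, (superformMk_eq_iff.2 ?_).symm⟩
    intro x hx
    have hvan := h.radialHomotopy_mem_vanishing (superformMk_eq_zero_iff.1 ha) x hx
    rwa [radialHomotopy_extDeriv_zero hV hVx hαV (mem_open_of_mem hVΩ hx)] at hvan
  | succ p =>
    refine ⟨⊥, Submodule.fg_bot, fun a ha => ?_⟩
    refine Submodule.mem_sup_left ?_
    obtain ⟨α, hα, rfl⟩ := exists_superformMk a
    obtain ⟨V, hV, hVx, hVΩ, hαV⟩ := h.exists_starConvex hα
    have hK : radialHomotopy x₀ α ∈ C.representatives p q Ω :=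
      ⟨V, hV, hVΩ, contDiffOn_radialHomotopy hV hVx hαV⟩
    refine ⟨superformMk _ hK, (superformMk_eq_iff.2 ?_).symm⟩
    intro x hx
    have hvan := h.radialHomotopy_mem_vanishing (superformMk_eq_zero_iff.1 ha) x hx
    rwa [Pi.sub_apply, ← extDeriv_radialHomotopy hV hVx hαV (mem_open_of_mem hVΩ hx),
      add_sub_cancel_left]

end PolyhedralComplex

/-! ### Cohomology of unions of open stars -/

namespace PolyhedralComplex

universe u

variable {E : Type u} [NormedAddCommGroup E] [NormedSpace ℝ E] {C : PolyhedralComplex E} {p q : ℕ}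

theorem finiteModExact_bot : C.FiniteModExact p q ⊥ := by
  refine ⟨⊥, Submodule.fg_bot, fun a _ => ?_⟩
  obtain ⟨α, hα, rfl⟩ := exists_superformMk a
  rw [superformMk_eq_zero_iff.2 fun x hx => (hx : x ∈ (∅ : Set _)).elim]
  exact zero_mem _

theorem finiteModExact_openStar [FiniteDimensional ℝ E] {T : Set E} (hT : T.Nonempty) :
    C.FiniteModExact p q (C.openStar T) := by
  by_cases h : ∃ σ ∈ C.polyhedra, T ⊆ σ
  · obtain ⟨σ, hσ, hTσ⟩ := h
    obtain ⟨x₀, hx₀⟩ := C.exists_isStarShaped_openStar hT hσ hTσ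
    exact IsStarShaped.finiteModExact hx₀
  · convert C.finiteModExact_bot
    refine eq_bot_iff.2 fun x hx => ?_
    obtain ⟨σ, hσ, hxσ⟩ := x.2
    exact h ⟨σ, hσ, hx σ hσ hxσ⟩

/-- Finite unions of open stars have finite-dimensional cohomology. The induction covers all
families of `n` sets and all degrees at once: the intersection of the star of `T a` with the union of
the stars of the `T i` is the union of the stars of the `T a ∪ T i`. -/
theorem finiteModExact_sup_openStar [FiniteDimensional ℝ E] {ι : Type*} (s : Finset ι) :
    ∀ (T : ι → Set E), (∀ i ∈ s, (T i).Nonempty) → ∀ p,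
      C.FiniteModExact p q (s.sup fun i => C.openStar (T i)) := by
  classical
  induction s using Finset.induction_on with
  | empty => exact fun _ _ _ => finiteModExact_bot
  | insert a s _ ih =>
    intro T hT p
    rw [Finset.sup_insert]
    refine (finiteModExact_openStar (hT a (by simp))).sup
      (ih T (fun i hi => hT i (by simp [hi])) p) fun p' _ => ?_
    rw [Finset.sup_inf_distrib_left]
    simp only [openStar_inf_openStar]
    exact ih _ (fun i _ => (hT a (by simp)).inl) p'

variable (C) in
/-- The support is covered by the stars of the nonempty members: a point lies in the star of the
smallest member containing it. -/
theorem exists_finset_sup_openStar_eq_top :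
    ∃ s : Finset (Set E), (∀ τ ∈ s, τ.Nonempty) ∧ (s.sup fun τ => C.openStar τ) = ⊤ := by
  have hfin : {τ ∈ C.polyhedra | τ.Nonempty}.Finite :=
    C.finite_polyhedra.subset (Set.sep_subset _ _)
  refine ⟨hfin.toFinset, fun τ hτ => (hfin.mem_toFinset.1 hτ).2, top_le_iff.1 fun x _ => ?_⟩
  obtain ⟨σ₀, hσ₀, hx⟩ := x.2
  obtain ⟨ρ, hρ, hxρ, hmin⟩ :=
    exists_least (Set.singleton_nonempty (x : E)) hσ₀ (Set.singleton_subset_iff.2 hx)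
  exact Finset.le_sup (f := fun τ => C.openStar τ) (hfin.mem_toFinset.2 ⟨hρ, x, hxρ rfl⟩)
    fun σ hσ hxσ => hmin σ hσ (Set.singleton_subset_iff.2 hxσ)

end PolyhedralComplex

end

theorem theorem3p9 (r : ℕ) (C : PolyhedralComplex (EuclideanSpace ℝ (Fin r))) (p q : ℕ) :
    FiniteDimensional ℝ (C.Cohomology p q (⊤ : TopologicalSpace.Opens C.support)) := by
  obtain ⟨s, hs, htop⟩ := C.exists_finset_sup_openStar_eq_top
  rw [← htop]
  exact (PolyhedralComplex.finiteModExact_sup_openStar s _ hs p).finiteDimensional
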